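/- **Theorem 1.2.** A family of sets is *$k$-pierceable* if it can be split into $k$ or fewer subfamilies, each having a nonempty intersection (equivalently, for sets in $\mathbb R^d$, some set of at most $k$ points meets every member). The *piercing number* $P(\mathcal H)\in\{0,1,2,\dots\}\cup\{\infty\}$ of a family $\mathcal H$ is the least $k$ for which $\mathcal H$ is $k$-pierceable, and $\infty$ if there is no such $k$. For integers $p\ge q$, a family has the *$(p,q)$ property* if it has at least $p$ members and among any $p$ of its members some $q$ have a nonempty intersection. Let $M(p,q;d)\in\{0,1,2,\dots\}\cup\{\infty\}$ be the largest possible piercing number of a family of nonempty compact convex sets in $\mathbb R^d$ with the $(p,q)$ property. Let $d\ge 1$ and $x\ge 0$ be integers, and let $\mathcal F$ be a (finite or infinite) family of compact convex sets in $\mathbb R^d$ with at least $x$ members. Suppose that for every subfamily $\mathcal F'\subseteq\mathcal F$ of cardinality $x$ the inequality $P(\mathcal F')<\lceil x/d\rceil$ holds, i.e. $\mathcal F'$ can be pierced by fewer than $x/d$ points. Then $$P(\mathcal F)\le M(x,d+1;d)<\infty .$$ -/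

import Mathlib

/-- A family of sets is `k`-pierceable if it can be split into `k` or fewer subfamilies, each having
a nonempty intersection. (Some parts `G i` may be empty, whence "or fewer": the intersection of the
empty subfamily is the whole space.) -/
def IsPierceable {α : Type*} (k : ℕ) (H : Set (Set α)) : Prop :=
  ∃ G : Fin k → Set (Set α),
    (∀ i j, i ≠ j → Disjoint (G i) (G j)) ∧ (⋃ i, G i) = H ∧ ∀ i, (⋂₀ G i).Nonempty

/-- The piercing number of a family of sets: the least `k` such that the family is `k`-pierceable,
and `⊤` if there is no such `k`. -/
noncomputable def piercingNumber {α : Type*} (H : Set (Set α)) : ℕ∞ :=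
  sInf {n : ℕ∞ | ∃ k : ℕ, n = k ∧ IsPierceable k H}

/-- The `(p, q)` property of a family of sets: the family has at least `p` members, and among any
`p` (distinct) members some `q` have a nonempty intersection. -/
def HasPQProperty {α : Type*} (p q : ℕ) (H : Set (Set α)) : Prop :=
  (p : ℕ∞) ≤ H.encard ∧
    ∀ S : Finset (Set α), (S : Set (Set α)) ⊆ H → S.card = p →
      ∃ T : Finset (Set α), T ⊆ S ∧ T.card = q ∧ (⋂₀ (T : Set (Set α))).Nonempty

/-- The number `M(p, q; d)`: the largest possible piercing number (possibly `⊤`) of a family of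
nonempty compact convex sets in `ℝ^d` with the `(p, q)` property. -/
noncomputable def pqNumber (p q d : ℕ) : ℕ∞ :=
  sSup {n : ℕ∞ | ∃ H : Set (Set (EuclideanSpace ℝ (Fin d))),
    (∀ A ∈ H, A.Nonempty ∧ IsCompact A ∧ Convex ℝ A) ∧ HasPQProperty p q H ∧
      n = piercingNumber H}

/-!
If `x` members of `F` can be pierced by `k < x / d` points, then one of these points lies in more
than `d` of them. So `F` has the `(x, d + 1)` property, its members are nonempty, and `F` is one of
the families over which the supremum `M(x, d + 1; d)` is taken. What has to be shown is that this
supremum is finite (`pqNumber_lt_top`): this is the theorem of Alon and Kleitman, valid for all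
`(p, d + 1)`. The proof works throughout with finite weighted families.

* Fractional Helly (`exists_tupleMass_le_mass`): if a positive proportion of the `(d + 1)`-tuples of
  a family of compact convex sets intersects, then some point lies in a positive proportion of the
  sets. Indeed, the point of minimal norm in the intersection of a `(d + 1)`-tuple is determined by
  `d` of its members, by Helly's theorem, so by averaging some such point belongs to many further
  sets. Drawing tuples with replacement according to the weights makes the counting exact.
* Duality (`exists_weights_forall_le_mass`): a family with the `(p, d + 1)` property retains, for
  every weighting, a proportion of intersecting `(d + 1)`-tuples that depends only on `p` and `d`.
  Hence for every weighting some point lies in a fixed proportion `β` of the sets, and Hahn–Banach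
  separation gives a finitely supported probability distribution on the points under which each set
  has probability at least `β`.
* Weak nets (`exists_weak_net`): boundedly many points meet every convex set of probability at
  least `β`. They are found greedily. Each point comes from the first selection lemma
  (`exists_one_le_mul_tupleMass_convexHull`), which in turn follows from fractional Helly for the
  family of all simplices; that many tuples of simplices intersect is seen by stripping
  Carathéodory simplices off a centerpoint.

The resulting bound does not depend on the finite family, and an ultrafilter limit carries it over
to infinite families (`exists_piercing_of_forall_finset`).
-/

open Module

/-! ### Weighted tuples -/

open Classical in
/-- The total weight of the tuples `t : κ → ι` satisfying `P`, where a tuple has the product of the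
weights of its entries as weight. For weights summing to `1`, this is the probability that a tuple
of independent random elements of `ι` satisfies `P`. -/
noncomputable def tupleMass {κ ι : Type*} [Fintype κ] [DecidableEq κ] [Fintype ι] (w : ι → ℝ)
    (P : (κ → ι) → Prop) : ℝ :=
  ∑ t, if P t then ∏ k, w (t k) else 0

open Classical in
/-- The total weight of the elements satisfying `P`. -/
noncomputable def mass {ι : Type*} [Fintype ι] (w : ι → ℝ) (P : ι → Prop) : ℝ :=
  ∑ i, if P i then w i else 0

section Mass

variable {κ ι : Type*} [Fintype κ] [DecidableEq κ] [Fintype ι] {w : ι → ℝ}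

theorem sum_prod_tuple (hw1 : ∑ i, w i = 1) : ∑ t : κ → ι, ∏ k, w (t k) = 1 := by
  rw [← Fintype.piFinset_univ, Finset.sum_prod_piFinset]
  simp [hw1]

theorem tupleMass_nonneg (hw0 : ∀ i, 0 ≤ w i) (P : (κ → ι) → Prop) : 0 ≤ tupleMass w P :=
  Finset.sum_nonneg fun t _ => by
    split_ifs
    · exact Finset.prod_nonneg fun k _ => hw0 _
    · exact le_rfl

/-- The entries of a tuple indexed by an embedded copy of `κ` are distributed as a `κ`-tuple. -/
theorem tupleMass_comp {β : Type*} [Fintype β] [DecidableEq β] (hw1 : ∑ i, w i = 1)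
    {e : κ → β} (he : Function.Injective e) (P : (κ → ι) → Prop) :
    tupleMass w (fun f : β → ι => P (f ∘ e)) = tupleMass w P := by
  classical
  let γ := ((Set.range e)ᶜ : Set β)
  let σ : κ ⊕ γ ≃ β :=
    ((Equiv.ofInjective e he).sumCongr (Equiv.refl _)).trans (Equiv.Set.sumCompl (Set.range e))
  let Φ : (κ → ι) × (γ → ι) ≃ (β → ι) :=
    (Equiv.sumArrowEquivProdArrow κ γ ι).symm.trans (σ.arrowCongr (Equiv.refl ι))
  have hΦ : ∀ a c, Φ (a, c) = Sum.elim a c ∘ σ.symm := fun a c => rfl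
  have hσ : ∀ k, σ.symm (e k) = Sum.inl k := by
    intro k
    rw [Equiv.symm_apply_eq]
    exact (Equiv.Set.sumCompl_apply_inl (Set.range e) ⟨e k, k, rfl⟩).symm
  have hcomp : ∀ a c, Φ (a, c) ∘ e = a := by
    intro a c
    funext k
    simp [hΦ, hσ]
  have hprod : ∀ a c, ∏ b, w (Φ (a, c) b) = (∏ k, w (a k)) * ∏ g, w (c g) := by
    intro a c
    rw [← Equiv.prod_comp σ]
    simp [hΦ, Fintype.prod_sum_type]
  unfold tupleMass
  rw [← Equiv.sum_comp Φ, Fintype.sum_prod_type]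
  refine Finset.sum_congr rfl fun a _ => ?_
  simp only [hcomp, hprod]
  split_ifs
  · rw [← Finset.mul_sum, sum_prod_tuple hw1, mul_one]
  · simp

/-- If every `N`-tuple contains a sub-tuple with property `P`, then a positive proportion of the
`κ`-tuples has property `P`: this is the union bound over the possible positions. -/
theorem one_le_mul_tupleMass (hw0 : ∀ i, 0 ≤ w i) (hw1 : ∑ i, w i = 1) {N : ℕ}
    {P : (κ → ι) → Prop}
    (h : ∀ f : Fin N → ι, ∃ e : κ → Fin N, Function.Injective e ∧ P (f ∘ e)) :
    1 ≤ (N : ℝ) ^ Fintype.card κ * tupleMass w P := by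
  classical
  have h0 : ∀ {β : Type} [Fintype β] (f : β → ι), 0 ≤ ∏ k, w (f k) :=
    fun f => Finset.prod_nonneg fun k _ => hw0 _
  calc (1 : ℝ) = ∑ f : Fin N → ι, ∏ k, w (f k) := (sum_prod_tuple hw1).symm
    _ ≤ ∑ f : Fin N → ι, ∑ e : κ → Fin N with Function.Injective e,
          if P (f ∘ e) then ∏ k, w (f k) else 0 := by
        refine Finset.sum_le_sum fun f _ => ?_
        obtain ⟨e, he, hP⟩ := h f
        calc _ = if P (f ∘ e) then ∏ k, w (f k) else 0 := by rw [if_pos hP]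
          _ ≤ _ := Finset.single_le_sum
            (f := fun e : κ → Fin N => if P (f ∘ e) then ∏ k, w (f k) else 0)
            (fun e _ => by split_ifs; exacts [h0 f, le_rfl]) (by simpa using he)
    _ = ∑ e : κ → Fin N with Function.Injective e, tupleMass w P := by
        rw [Finset.sum_comm]
        refine Finset.sum_congr rfl fun e he => ?_
        rw [← tupleMass_comp hw1 (Finset.mem_filter.1 he).2 P]
        unfold tupleMass
        exact Finset.sum_congr rfl fun f _ => by congr
    _ ≤ ∑ _e : κ → Fin N, tupleMass w P :=
        Finset.sum_le_sum_of_subset_of_nonneg (Finset.filter_subset _ _)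
          fun _ _ _ => tupleMass_nonneg hw0 P
    _ = _ := by simp

end Mass

/-! ### The fractional Helly theorem -/

section Helly

variable {E : Type*} [NormedAddCommGroup E] [InnerProductSpace ℝ E]

/-- A convex set has at most one point of minimal norm. -/
theorem Convex.eq_of_norm_min {K : Set E} (hK : Convex ℝ K) {u v : E} (hu : u ∈ K) (hv : v ∈ K)
    (hu' : ∀ y ∈ K, ‖u‖ ≤ ‖y‖) (hv' : ∀ y ∈ K, ‖v‖ ≤ ‖y‖) : u = v := by
  have huv : ‖u‖ = ‖v‖ := le_antisymm (hu' v hv) (hv' u hu)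
  by_contra hne
  have hm : (1 / 2 : ℝ) • u + (1 / 2 : ℝ) • v ∈ K :=
    hK hu hv (by norm_num) (by norm_num) (by norm_num)
  have h1 := hu' _ hm
  have h2 := parallelogram_law_with_norm ℝ u v
  have h3 : 0 < ‖u - v‖ := norm_pos_iff.2 (sub_ne_zero.2 hne)
  rw [← smul_add, norm_smul] at h1
  norm_num at h1
  rw [← huv] at h2
  nlinarith [norm_nonneg u, norm_nonneg (u + v)]

variable [FiniteDimensional ℝ E]

/-- In dimension `d`, the point of minimal norm in an intersection of `d + 1` convex sets is already
the point of minimal norm in the intersection of some `d` of them. This is Helly's theorem for the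
given sets together with an open ball about the origin. -/
theorem exists_forall_norm_le_of_succAbove {d : ℕ} (hd : finrank ℝ E = d)
    {C : Fin (d + 1) → Set E} (hC : ∀ k, Convex ℝ (C k)) {v : E} (hv : ∀ k, v ∈ C k)
    (hmin : ∀ y, (∀ k, y ∈ C k) → ‖v‖ ≤ ‖y‖) :
    ∃ k : Fin (d + 1), ∀ y, (∀ j, y ∈ C (k.succAbove j)) → ‖v‖ ≤ ‖y‖ := by
  classical
  by_contra! hcon
  let D : Option (Fin (d + 1)) → Set E := fun o => o.elim (Metric.ball 0 ‖v‖) C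
  have hD : (⋂ o ∈ (Finset.univ : Finset (Option (Fin (d + 1)))), D o).Nonempty := by
    refine Convex.helly_theorem (𝕜 := ℝ) (by simp [hd]) ?_ ?_
    · rintro (_ | k) -
      · exact convex_ball _ _
      · exact hC k
    · intro I _ hI
      obtain ⟨o, ho⟩ : ∃ o, o ∉ I := by
        by_contra! hall
        rw [Finset.eq_univ_of_forall hall] at hI
        simp [hd] at hI
      rcases o with _ | k
      · refine ⟨v, ?_⟩
        simp only [Set.mem_iInter]
        rintro (_ | k) hk
        · exact absurd hk ho
        · exact hv k
      · obtain ⟨y, hy, hlt⟩ := hcon k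
        refine ⟨y, ?_⟩
        simp only [Set.mem_iInter]
        rintro (_ | j) hj
        · simpa [D] using hlt
        · have hjk : j ≠ k := fun h => ho (h ▸ hj)
          obtain ⟨i, rfl⟩ := Fin.exists_succAbove_eq hjk
          exact hy i
  obtain ⟨y, hy⟩ := hD
  simp only [Set.mem_iInter] at hy
  have h1 := hmin y fun k => hy (some k) (Finset.mem_univ _)
  have h2 : y ∈ Metric.ball (0 : E) ‖v‖ := hy none (Finset.mem_univ _)
  rw [mem_ball_zero_iff] at h2
  linarith

/-- **Fractional Helly theorem**, weighted form: if the intersecting `(d + 1)`-tuples of a finite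
weighted family of compact convex sets have total weight `α`, then some point lies in members of the
family of total weight at least `α / (d + 1)`. -/
theorem exists_tupleMass_le_mass {d : ℕ} (hd : finrank ℝ E = d) {ι : Type*} [Fintype ι]
    {w : ι → ℝ} (hw0 : ∀ i, 0 ≤ w i) (hw1 : ∑ i, w i = 1) {C : ι → Set E}
    (hcomp : ∀ i, IsCompact (C i)) (hconv : ∀ i, Convex ℝ (C i)) :
    ∃ x : E, tupleMass w (fun t : Fin (d + 1) → ι => ∃ y, ∀ k, y ∈ C (t k)) ≤
      (d + 1) * mass w (fun i => x ∈ C i) := by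
  classical
  have : Nonempty ι := by
    by_contra h
    rw [not_nonempty_iff] at h
    simp at hw1
  -- `v s` is the point of minimal norm of the intersection, whenever there is one.
  have hv : ∀ s : Fin d → ι, ∃ v : E, ∀ u, (∀ j, u ∈ C (s j)) →
      (∀ y, (∀ j, y ∈ C (s j)) → ‖u‖ ≤ ‖y‖) → v = u := by
    intro s
    by_cases h : ∃ v, (∀ j, v ∈ C (s j)) ∧ ∀ y, (∀ j, y ∈ C (s j)) → ‖v‖ ≤ ‖y‖
    · obtain ⟨v, hv, hv'⟩ := h
      refine ⟨v, fun u hu hu' => ?_⟩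
      refine Convex.eq_of_norm_min (K := ⋂ j, C (s j)) (convex_iInter fun j => hconv _) ?_ ?_ ?_ ?_
      all_goals simpa only [Set.mem_iInter]
    · push Not at h
      exact ⟨0, fun u hu hu' => by
        obtain ⟨y, hy, hlt⟩ := h u hu
        exact absurd (hu' y hy) (not_le.2 hlt)⟩
  choose v hv using hv
  have key : ∀ t : Fin (d + 1) → ι, (∃ y, ∀ k, y ∈ C (t k)) →
      ∃ k, v (k.removeNth t) ∈ C (t k) := by
    rintro t ⟨y, hy⟩
    have hK : IsCompact (⋂ k, C (t k)) :=
      (hcomp (t 0)).of_isClosed_subset (isClosed_iInter fun k => (hcomp (t k)).isClosed)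
        (Set.iInter_subset _ 0)
    obtain ⟨u, hu, hmin⟩ := hK.exists_isMinOn ⟨y, Set.mem_iInter.2 hy⟩ continuous_norm.continuousOn
    rw [Set.mem_iInter] at hu
    obtain ⟨k, hk⟩ := exists_forall_norm_le_of_succAbove hd (C := fun k => C (t k))
      (fun k => hconv _) hu (fun y hy => hmin (Set.mem_iInter.2 hy))
    refine ⟨k, ?_⟩
    rw [hv (k.removeNth t) u (fun j => hu _) hk]
    exact hu k
  obtain ⟨s₀, hs₀⟩ := Finite.exists_max fun s : Fin d → ι => mass w fun i => v s ∈ C i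
  refine ⟨v s₀, ?_⟩
  have h0 : ∀ {β : Type} [Fintype β] (f : β → ι), 0 ≤ ∏ k, w (f k) :=
    fun f => Finset.prod_nonneg fun k _ => hw0 _
  have hterm : ∀ (k : Fin (d + 1)) (t : Fin (d + 1) → ι),
      0 ≤ if v (k.removeNth t) ∈ C (t k) then ∏ j, w (t j) else 0 := fun k t => by
    split_ifs
    exacts [h0 t, le_rfl]
  calc _ ≤ ∑ t : Fin (d + 1) → ι, ∑ k : Fin (d + 1),
        (if v (k.removeNth t) ∈ C (t k) then ∏ j, w (t j) else 0) := by
        refine Finset.sum_le_sum fun t _ => ?_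
        split_ifs with h
        · obtain ⟨k, hk⟩ := key t h
          exact (if_pos hk).symm.le.trans
            (Finset.single_le_sum (fun k _ => hterm k t) (Finset.mem_univ k))
        · exact Finset.sum_nonneg fun k _ => hterm k t
    _ = ∑ _k : Fin (d + 1), ∑ s : Fin d → ι, (∏ j, w (s j)) * mass w fun i => v s ∈ C i := by
        rw [Finset.sum_comm]
        refine Finset.sum_congr rfl fun k _ => ?_
        rw [← Equiv.sum_comp (Fin.insertNthEquiv (fun _ => ι) k), Fintype.sum_prod_type_right]
        refine Finset.sum_congr rfl fun s _ => ?_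
        rw [mass, Finset.mul_sum]
        refine Finset.sum_congr rfl fun i _ => ?_
        simp [Fin.insertNthEquiv, Fin.prod_univ_succAbove _ k, mul_comm]
    _ ≤ ∑ _k : Fin (d + 1), ∑ s : Fin d → ι, (∏ j, w (s j)) * mass w fun i => v s₀ ∈ C i :=
        Finset.sum_le_sum fun k _ => Finset.sum_le_sum fun s _ =>
          mul_le_mul_of_nonneg_left (hs₀ s) (h0 s)
    _ = _ := by
        rw [← Finset.sum_mul, sum_prod_tuple hw1]
        simp

end Helly

/-! ### Centerpoints and selection -/

section Selection

variable {E : Type*} [NormedAddCommGroup E] [InnerProductSpace ℝ E] [FiniteDimensional ℝ E]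

/-- **Centerpoint theorem**: some point stays in the convex hull of a finite system of points
whichever small part of the system is removed. -/
theorem exists_mem_convexHull_image_compl {N m : ℕ} (hN : (finrank ℝ E + 1) * m < N)
    (f : Fin N → E) :
    ∃ c, ∀ R : Finset (Fin N), R.card ≤ m → c ∈ convexHull ℝ (f '' (R : Set (Fin N))ᶜ) := by
  classical
  have h : (⋂ R ∈ (Finset.univ.filter fun R : Finset (Fin N) => R.card ≤ m),
      convexHull ℝ (f '' (R : Set (Fin N))ᶜ)).Nonempty := by
    refine Convex.helly_theorem' (𝕜 := ℝ) (fun R _ => convex_convexHull ℝ _) fun I hI hcard => ?_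
    have h1 : (I.biUnion id).card < N := by
      refine lt_of_le_of_lt (Finset.card_biUnion_le_card_mul I id m fun R hR => ?_) ?_
      · exact (Finset.mem_filter.1 (hI hR)).2
      · exact lt_of_le_of_lt (Nat.mul_le_mul_right m hcard) hN
    obtain ⟨j, hj⟩ : ∃ j, j ∉ I.biUnion id := by
      by_contra! hall
      rw [Finset.eq_univ_of_forall hall] at h1
      simp at h1
    refine ⟨f j, ?_⟩
    simp only [Set.mem_iInter]
    intro R hR
    refine subset_convexHull ℝ _ ⟨j, fun hjR => hj ?_, rfl⟩
    exact Finset.mem_biUnion.2 ⟨R, hR, hjR⟩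
  obtain ⟨c, hc⟩ := h
  simp only [Set.mem_iInter] at hc
  exact ⟨c, fun R hR => hc R (by simpa using hR)⟩

/-- Carathéodory's theorem for an indexed system of points, with a simplex that may be enlarged by
superfluous vertices so as to have exactly `d + 1` of them. -/
theorem exists_card_eq_mem_convexHull_image {d N : ℕ} (hd : finrank ℝ E = d) (f : Fin N → E)
    {A : Finset (Fin N)} (hA : d + 1 ≤ A.card) {c : E}
    (hc : c ∈ convexHull ℝ (f '' (A : Set (Fin N)))) :
    ∃ B ⊆ A, B.card = d + 1 ∧ c ∈ convexHull ℝ (f '' (B : Set (Fin N))) := by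
  classical
  rw [convexHull_eq_union] at hc
  simp only [Set.mem_iUnion] at hc
  obtain ⟨t, htA, hind, hct⟩ := hc
  have htc : t.card ≤ d + 1 := by
    have := hind.card_le_finrank_succ
    rw [Fintype.card_coe] at this
    refine this.trans (Nat.succ_le_succ ?_)
    rw [← hd]
    exact Submodule.finrank_le _
  obtain ⟨u, huA, hfu, hut⟩ := Finset.exists_subset_injOn_image_eq_of_surjOn (f := f) A t htA
  have huA' : u ⊆ A := by exact_mod_cast huA
  have hucard : u.card ≤ d + 1 := by
    rw [← hut, Finset.card_image_of_injOn hfu] at htc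
    exact htc
  obtain ⟨B, huB, hBA, hB⟩ := Finset.exists_subsuperset_card_eq huA' hucard hA
  refine ⟨B, hBA, hB, convexHull_mono ?_ hct⟩
  rw [← hut, Finset.coe_image]
  exact Set.image_mono (by exact_mod_cast huB)

/-- Among sufficiently many points there are `d + 1` disjoint systems of `d + 1` points each whose
convex hulls have a common point. Carathéodory simplices about a centerpoint can be removed one
after the other. -/
theorem exists_injective_mem_convexHull {d N : ℕ} (hd : finrank ℝ E = d)
    (hN : (d + 1) * ((d + 1) * (d + 1)) < N) (f : Fin N → E) :
    ∃ e : Fin (d + 1) × Fin (d + 1) → Fin N, Function.Injective e ∧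
      ∃ c, ∀ k, c ∈ convexHull ℝ (Set.range fun j => f (e (k, j))) := by
  classical
  obtain ⟨c, hc⟩ := exists_mem_convexHull_image_compl (m := (d + 1) * (d + 1)) (by rwa [hd]) f
  have step : ∀ n ≤ d + 1, ∃ S : ℕ → Finset (Fin N),
      (∀ i < n, (S i).card = d + 1 ∧ c ∈ convexHull ℝ (f '' (S i : Set (Fin N)))) ∧
      ∀ i < n, ∀ j < i, Disjoint (S j) (S i) := by
    intro n
    induction n with
    | zero => exact fun _ => ⟨fun _ => ∅, by simp, by simp⟩
    | succ n ih =>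
      intro hn
      obtain ⟨S, hS, hdisj⟩ := ih (by lia)
      let R := (Finset.range n).biUnion S
      have hRn : R.card ≤ n * (d + 1) := by
        refine (Finset.card_biUnion_le_card_mul _ S (d + 1) fun i hi => ?_).trans (by simp)
        exact (hS i (Finset.mem_range.1 hi)).1.le
      have hR : R.card ≤ (d + 1) * (d + 1) := hRn.trans (Nat.mul_le_mul_right _ (by lia))
      have hcR := hc R hR
      rw [← Finset.coe_compl] at hcR
      have hcard : d + 1 ≤ Rᶜ.card := by
        rw [Finset.card_compl, Fintype.card_fin]
        have h1 : R.card ≤ d * (d + 1) := hRn.trans (Nat.mul_le_mul_right _ (by lia))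
        have h2 : d + 1 + d * (d + 1) ≤ (d + 1) * ((d + 1) * (d + 1)) := by nlinarith [Nat.zero_le d]
        lia
      obtain ⟨B, hBR, hB, hcB⟩ := exists_card_eq_mem_convexHull_image hd f hcard hcR
      refine ⟨Function.update S n B, ?_, ?_⟩
      · intro i hi
        rcases Nat.lt_succ_iff_lt_or_eq.1 hi with h | rfl
        · rw [Function.update_of_ne h.ne]
          exact hS i h
        · rw [Function.update_self]
          exact ⟨hB, hcB⟩
      · intro i hi j hj
        rw [Function.update_of_ne (show j ≠ n by lia)]
        rcases Nat.lt_succ_iff_lt_or_eq.1 hi with h | rfl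
        · rw [Function.update_of_ne h.ne]
          exact hdisj i h j hj
        · rw [Function.update_self]
          refine Finset.disjoint_left.2 fun a ha haB => ?_
          exact Finset.mem_compl.1 (hBR haB)
            (Finset.mem_biUnion.2 ⟨j, Finset.mem_range.2 hj, ha⟩)
  obtain ⟨S, hS, hdisj⟩ := step (d + 1) le_rfl
  let e : Fin (d + 1) × Fin (d + 1) → Fin N :=
    fun p => (S p.1).orderEmbOfFin (hS p.1 p.1.2).1 p.2
  have he : ∀ p, e p ∈ S p.1 := fun p => Finset.orderEmbOfFin_mem _ _ _
  refine ⟨e, ?_, c, fun k => ?_⟩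
  · rintro ⟨k, j⟩ ⟨k', j'⟩ h
    have hk := he (k, j)
    have hk' := he (k', j')
    rw [← h] at hk'
    rcases lt_trichotomy (k : ℕ) k' with hlt | heq | hlt
    · exact absurd hk' (Finset.disjoint_left.1 (hdisj k' k'.2 k hlt) hk)
    · obtain rfl := Fin.ext heq
      exact congrArg (Prod.mk k) (((S k).orderEmbOfFin (hS k k.2).1).injective h)
    · exact absurd hk (Finset.disjoint_left.1 (hdisj k k.2 k' hlt) hk')
  · convert (hS k k.2).2 using 2
    rw [← Finset.range_orderEmbOfFin (S k) (hS k k.2).1, ← Set.range_comp]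
    rfl

/-- **First selection lemma**, weighted form: some point lies in a positive proportion, depending
only on the dimension, of the simplices spanned by a finite weighted system of points. This is the
fractional Helly theorem applied to the family of all these simplices. -/
theorem exists_one_le_mul_tupleMass_convexHull {d N : ℕ} (hd : finrank ℝ E = d)
    (hN : (d + 1) * ((d + 1) * (d + 1)) < N) {κ : Type*} [Fintype κ] {μ : κ → ℝ}
    (hμ0 : ∀ i, 0 ≤ μ i) (hμ1 : ∑ i, μ i = 1) (x : κ → E) :
    ∃ c, 1 ≤ (N : ℝ) ^ ((d + 1) * (d + 1)) * ((d + 1) *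
      tupleMass μ fun t : Fin (d + 1) → κ => c ∈ convexHull ℝ (Set.range fun j => x (t j))) := by
  classical
  obtain ⟨c, hc⟩ := exists_tupleMass_le_mass hd (ι := Fin (d + 1) → κ)
    (w := fun t => ∏ j, μ (t j)) (fun t => Finset.prod_nonneg fun j _ => hμ0 _)
    (sum_prod_tuple hμ1) (C := fun t => convexHull ℝ (Set.range fun j => x (t j)))
    (fun t => (Set.finite_range _).isCompact_convexHull ℝ) (fun t => convex_convexHull ℝ _)
  refine ⟨c, ?_⟩
  have h1 := one_le_mul_tupleMass (κ := Fin (d + 1) × Fin (d + 1)) (N := N) hμ0 hμ1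
    (P := fun g => ∃ y, ∀ k, y ∈ convexHull ℝ (Set.range fun j => x (g (k, j))))
    (fun f => exists_injective_mem_convexHull hd hN (fun i => x (f i)))
  have h2 : tupleMass μ (fun g : Fin (d + 1) × Fin (d + 1) → κ =>
        ∃ y, ∀ k, y ∈ convexHull ℝ (Set.range fun j => x (g (k, j)))) =
      tupleMass (fun t : Fin (d + 1) → κ => ∏ j, μ (t j)) (fun T : Fin (d + 1) → _ =>
        ∃ y, ∀ k, y ∈ convexHull ℝ (Set.range fun j => x (T k j))) := by
    unfold tupleMass
    rw [← Equiv.sum_comp (Equiv.curry (Fin (d + 1)) (Fin (d + 1)) κ)]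
    refine Finset.sum_congr rfl fun g _ => ?_
    rw [Fintype.prod_prod_type]
    rfl
  rw [h2] at h1
  refine h1.trans ?_
  rw [Fintype.card_prod, Fintype.card_fin]
  exact mul_le_mul_of_nonneg_left hc (by positivity)

end Selection

/-! ### Weak nets for convex sets -/

section WeakNet

variable {E : Type*} [NormedAddCommGroup E] [InnerProductSpace ℝ E] [FiniteDimensional ℝ E]

/-- **Weak `ε`-net theorem**: a number of points depending only on `ε` and the dimension suffices to
meet all convex sets that carry at least the proportion `ε` of a finite weighted system of points.
As long as such a set is missed, the selection lemma inside it yields a point that lies in a further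
fixed proportion of all simplices. -/
theorem exists_weak_net {d : ℕ} (hd : finrank ℝ E = d) {ε : ℝ} (hε : 0 < ε) :
    ∃ n : ℕ, ∀ (κ : Type) [Fintype κ] (μ : κ → ℝ) (x : κ → E), (∀ i, 0 ≤ μ i) → ∑ i, μ i = 1 →
      ∃ S : Finset E, S.card ≤ n ∧
        ∀ K, Convex ℝ K → ε ≤ mass μ (fun i => x i ∈ K) → ∃ c ∈ S, c ∈ K := by
  classical
  let N := (d + 1) * ((d + 1) * (d + 1)) + 1
  let A : ℝ := (N : ℝ) ^ ((d + 1) * (d + 1)) * (d + 1)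
  have hA : 0 < A := by positivity
  let δ := ε ^ (d + 1) / A
  have hδ : 0 < δ := by positivity
  obtain ⟨n, hn⟩ := exists_nat_gt (1 / δ)
  refine ⟨n, fun κ _ μ x hμ0 hμ1 => ?_⟩
  by_contra! hcon
  let Q : E → (Fin (d + 1) → κ) → Prop := fun c t => c ∈ convexHull ℝ (Set.range fun j => x (t j))
  have step : ∀ m ≤ n, ∃ S : Finset E, S.card ≤ m ∧ m * δ ≤ tupleMass μ fun t => ∃ c ∈ S, Q c t := by
    intro m
    induction m with
    | zero => exact fun _ => ⟨∅, by simp, by simp [tupleMass]⟩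
    | succ m ih =>
      intro hm
      obtain ⟨S, hS, hmass⟩ := ih (by lia)
      obtain ⟨K, hK, hεK, hSK⟩ := hcon S (by lia)
      let M := mass μ fun i => x i ∈ K
      have hM : 0 < M := hε.trans_le hεK
      let ν : κ → ℝ := fun i => (if x i ∈ K then μ i else 0) / M
      have hν0 : ∀ i, 0 ≤ ν i := fun i => by
        dsimp only [ν]
        split_ifs
        · exact div_nonneg (hμ0 i) hM.le
        · simp
      have hν1 : ∑ i, ν i = 1 := by
        dsimp only [ν]
        rw [← Finset.sum_div]
        exact div_self hM.ne'
      obtain ⟨c, hc⟩ := exists_one_le_mul_tupleMass_convexHull hd (Nat.lt_succ_self _) hν0 hν1 x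
      have hνμ : tupleMass ν (Q c) * M ^ (d + 1) =
          tupleMass μ fun t => Q c t ∧ ∀ j, x (t j) ∈ K := by
        unfold tupleMass
        rw [Finset.sum_mul]
        refine Finset.sum_congr rfl fun t _ => ?_
        by_cases h1 : Q c t
        · by_cases h2 : ∀ j, x (t j) ∈ K
          · simp only [h1, h2, ν, if_true, implies_true, and_true, Finset.prod_div_distrib]
            simp [hM.ne']
          · obtain ⟨j, hj⟩ := not_forall.1 h2
            rw [if_pos h1, if_neg fun h => h2 h.2,
              Finset.prod_eq_zero (Finset.mem_univ j) (by simp [ν, hj]), zero_mul]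
        · simp [h1]
      have hδc : δ ≤ tupleMass μ fun t => Q c t ∧ ∀ j, x (t j) ∈ K := by
        rw [← hνμ]
        have h1 : 1 ≤ A * tupleMass ν (Q c) := by
          refine hc.trans_eq ?_
          rw [← mul_assoc]
        have h2 : ε ^ (d + 1) ≤ M ^ (d + 1) := pow_le_pow_left₀ hε.le hεK _
        rw [div_le_iff₀ hA]
        calc ε ^ (d + 1) ≤ M ^ (d + 1) * 1 := by rwa [mul_one]
          _ ≤ M ^ (d + 1) * (A * tupleMass ν (Q c)) :=
            mul_le_mul_of_nonneg_left h1 (by positivity)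
          _ = _ := by ring
      refine ⟨insert c S, (Finset.card_insert_le _ _).trans (by lia), ?_⟩
      calc ((m + 1 : ℕ) : ℝ) * δ = m * δ + δ := by push_cast; ring
        _ ≤ _ := add_le_add hmass hδc
        _ ≤ _ := by
          unfold tupleMass
          rw [← Finset.sum_add_distrib]
          refine Finset.sum_le_sum fun t _ => ?_
          have h0 : 0 ≤ ∏ j, μ (t j) := Finset.prod_nonneg fun j _ => hμ0 _
          by_cases h1 : Q c t ∧ ∀ j, x (t j) ∈ K
          · -- The simplex lies in `K`, so no point of `S` belongs to it.
            have h2 : ¬ ∃ b ∈ S, Q b t := by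
              rintro ⟨b, hb, hbt⟩
              refine hSK b hb (convexHull_min ?_ hK hbt)
              rintro _ ⟨j, rfl⟩
              exact h1.2 j
            rw [if_neg h2, if_pos h1, if_pos ⟨c, Finset.mem_insert_self _ _, h1.1⟩, zero_add]
          · rw [if_neg h1, add_zero]
            split_ifs with h2 h3
            · exact le_rfl
            · obtain ⟨b, hb, hbt⟩ := h2
              exact absurd ⟨b, Finset.mem_insert_of_mem hb, hbt⟩ h3
            · exact h0
            · exact le_rfl
  obtain ⟨S, -, hS⟩ := step n le_rfl
  have h1 : tupleMass μ (fun t : Fin (d + 1) → κ => ∃ c ∈ S, Q c t) ≤ 1 := by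
    rw [← sum_prod_tuple (κ := Fin (d + 1)) hμ1]
    refine Finset.sum_le_sum fun t _ => ?_
    split_ifs
    · exact le_rfl
    · exact Finset.prod_nonneg fun j _ => hμ0 _
  rw [div_lt_iff₀ hδ] at hn
  linarith

end WeakNet

/-! ### Duality -/

/-- Linear programming duality: if for every weighting of a finite family of sets some point lies in
members of total weight at least `β`, then there is a finitely supported probability distribution on
the points that gives every member probability at least `β`. -/
theorem exists_weights_forall_le_mass {E ι : Type*} [Fintype ι] [Nonempty ι] {C : ι → Set E} {β : ℝ}
    (h : ∀ w : ι → ℝ, (∀ i, 0 ≤ w i) → ∑ i, w i = 1 → ∃ x, β ≤ mass w fun i => x ∈ C i) :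
    ∃ (κ : Type) (_ : Fintype κ) (μ : κ → ℝ) (x : κ → E), (∀ j, 0 ≤ μ j) ∧ ∑ j, μ j = 1 ∧
      ∀ i, β ≤ mass μ fun j => x j ∈ C i := by
  classical
  let φ : E → ι → ℝ := fun x i => if x ∈ C i then 1 else 0
  have hfin : (Set.range φ).Finite := by
    refine (Set.Finite.pi' fun _ : ι => Set.toFinite ({0, 1} : Set ℝ)).subset ?_
    rintro _ ⟨x, rfl⟩ i
    dsimp only [φ]
    split_ifs <;> simp
  by_cases hdisj : Disjoint (convexHull ℝ (Set.range φ)) (Set.Ici fun _ => β)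
  · exfalso
    obtain ⟨g, u, v, hgu, huv, hgv⟩ := geometric_hahn_banach_compact_closed
      (convex_convexHull ℝ _) (hfin.isCompact_convexHull ℝ) (convex_Ici _) isClosed_Ici hdisj
    let a : ι → ℝ := fun i => g (Pi.single i 1)
    have hg : ∀ z : ι → ℝ, g z = ∑ i, a i * z i := by
      intro z
      conv_lhs => rw [← Finset.univ_sum_single z]
      rw [map_sum]
      refine Finset.sum_congr rfl fun i _ => ?_
      have : Pi.single i (z i) = z i • (Pi.single i (1 : ℝ) : ι → ℝ) := by
        rw [← Pi.single_smul, smul_eq_mul, mul_one]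
      rw [this, map_smul, smul_eq_mul, mul_comm]
    have hgφ : ∀ x, g (φ x) = mass a fun i => x ∈ C i := by
      intro x
      rw [hg]
      refine Finset.sum_congr rfl fun i _ => ?_
      simp [φ]
    -- The functional is bounded below on an orthant, so its coefficients are nonnegative.
    have ha : ∀ i, 0 ≤ a i := by
      intro i
      by_contra! hneg
      let s := max 0 ((g (fun _ => β) - v) / (-a i))
      have hs : 0 ≤ s := le_max_left _ _
      have hsingle : (0 : ι → ℝ) ≤ Pi.single i 1 := Pi.single_nonneg.2 zero_le_one
      have h1 := hgv ((fun _ => β) + s • Pi.single i 1)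
        (le_add_of_nonneg_right (smul_nonneg hs hsingle))
      rw [map_add, map_smul, smul_eq_mul] at h1
      have h2 : (g (fun _ => β) - v) / (-a i) ≤ s := le_max_right _ _
      rw [div_le_iff₀ (by linarith)] at h2
      have h3 : g (Pi.single i 1) = a i := rfl
      rw [h3] at h1
      linarith
    have hβ : v < β * ∑ i, a i := by
      have := hgv (fun _ => β) Set.self_mem_Ici
      rwa [hg, ← Finset.sum_mul, mul_comm] at this
    have hup : ∀ x, mass a (fun i => x ∈ C i) < u := fun x => by
      rw [← hgφ]
      exact hgu _ (subset_convexHull ℝ _ ⟨x, rfl⟩)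
    obtain ⟨x₀, -⟩ := h (fun _ => (Fintype.card ι : ℝ)⁻¹) (fun _ => by positivity) (by simp)
    have hpos : 0 < ∑ i, a i := by
      refine lt_of_le_of_ne (Finset.sum_nonneg fun i _ => ha i) fun h0 => ?_
      have h1 := (Finset.sum_eq_zero_iff_of_nonneg fun i _ => ha i).1 h0.symm
      have h2 : mass a (fun i => x₀ ∈ C i) = 0 :=
        Finset.sum_eq_zero fun i hi => by rw [h1 i hi, ite_self]
      have h3 := hup x₀
      rw [h2] at h3
      rw [← h0] at hβ
      linarith
    obtain ⟨x, hx⟩ := h (fun i => a i / ∑ i, a i) (fun i => div_nonneg (ha i) hpos.le)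
      (by rw [← Finset.sum_div, div_self hpos.ne'])
    have h1 : mass (fun i => a i / ∑ i, a i) (fun i => x ∈ C i) =
        mass a (fun i => x ∈ C i) / ∑ i, a i := by
      unfold mass
      rw [Finset.sum_div]
      refine Finset.sum_congr rfl fun i _ => ?_
      split_ifs <;> simp
    rw [h1, le_div_iff₀ hpos] at hx
    linarith [hup x]
  · obtain ⟨z, hz, hzβ⟩ := Set.not_disjoint_iff.1 hdisj
    rw [convexHull_eq] at hz
    obtain ⟨κ, t, μ, y, hμ0, hμ1, hy, rfl⟩ := hz
    choose x hx using hy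
    refine ⟨t, inferInstance, fun j => μ j, fun j => x j j.2, fun j => hμ0 j j.2, ?_, fun i => ?_⟩
    · rw [← hμ1]
      exact Finset.sum_coe_sort t μ
    · have h1 := hzβ i
      rw [Finset.centerMass_eq_of_sum_1 _ _ hμ1, Finset.sum_apply] at h1
      refine h1.trans_eq ?_
      rw [← Finset.sum_coe_sort]
      refine Finset.sum_congr rfl fun j _ => ?_
      rw [Pi.smul_apply, ← hx j j.2]
      simp [φ]

/-! ### The `(p, d + 1)` theorem -/

/-- The `(p, q)` property passes to families with repetitions, for a larger `p`: a long tuple either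
repeats some member often, or contains `p` distinct members. -/
theorem exists_injective_mem_of_forall_card_eq {E : Type*} {p d : ℕ} {S : Finset (Set E)}
    (hne : ∀ A ∈ S, A.Nonempty)
    (h : ∀ U ⊆ S, U.card = p →
      ∃ T ⊆ U, T.card = d + 1 ∧ (⋂₀ (T : Set (Set E))).Nonempty) (f : Fin (d * p + 1) → S) :
    ∃ e : Fin (d + 1) → Fin (d * p + 1), Function.Injective e ∧
      ∃ y, ∀ k, y ∈ (f (e k) : Set E) := by
  classical
  let g : Fin (d * p + 1) → Set E := fun i => f i
  by_cases hfib : ∃ A ∈ Finset.univ.image g, d < (Finset.univ.filter fun i => g i = A).card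
  · obtain ⟨A, hA, hcard⟩ := hfib
    obtain ⟨i, -, rfl⟩ := Finset.mem_image.1 hA
    obtain ⟨y, hy⟩ := hne _ (f i).2
    refine ⟨Finset.orderEmbOfCardLe _ hcard, (Finset.orderEmbOfCardLe _ hcard).injective, y, ?_⟩
    intro k
    have := Finset.orderEmbOfCardLe_mem _ hcard k
    have h2 : g _ = g i := (Finset.mem_filter.1 this).2
    change y ∈ g _
    rw [h2]
    exact hy
  · push Not at hfib
    have h1 := Finset.card_le_mul_card_image (Finset.univ : Finset (Fin (d * p + 1))) d hfib
    rw [Finset.card_univ, Fintype.card_fin] at h1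
    have h2 : p ≤ (Finset.univ.image g).card := by
      by_contra! hlt
      have := Nat.mul_le_mul_left d hlt.le
      lia
    obtain ⟨U, hU, hUp⟩ := Finset.exists_subset_card_eq h2
    have hUS : U ⊆ S := fun A hA => by
      obtain ⟨i, -, rfl⟩ := Finset.mem_image.1 (hU hA)
      exact (f i).2
    obtain ⟨T, hTU, hT, y, hy⟩ := h U hUS hUp
    have hpre : ∀ A : T, ∃ i, g i = A := fun A => by
      obtain ⟨i, -, hi⟩ := Finset.mem_image.1 (hU (hTU A.2))
      exact ⟨i, hi⟩
    choose r hr using hpre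
    have hrinj : Function.Injective r := fun A B hAB =>
      Subtype.ext (by rw [← hr A, ← hr B, hAB])
    refine ⟨r ∘ (T.equivFinOfCardEq hT).symm, hrinj.comp (Equiv.injective _), y, fun k => ?_⟩
    change y ∈ g (r _)
    rw [hr]
    exact hy _ (Subtype.prop _)

/-- The **Alon–Kleitman theorem** for finite families. -/
theorem exists_forall_finset_piercing {E : Type*} [NormedAddCommGroup E] [InnerProductSpace ℝ E]
    [FiniteDimensional ℝ E] {d : ℕ} (hd : finrank ℝ E = d) (p : ℕ) :
    ∃ n : ℕ, ∀ S : Finset (Set E), (∀ A ∈ S, A.Nonempty ∧ IsCompact A ∧ Convex ℝ A) →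
      (∀ U ⊆ S, U.card = p → ∃ T ⊆ U, T.card = d + 1 ∧ (⋂₀ (T : Set (Set E))).Nonempty) →
      ∃ X : Finset E, X.card ≤ n ∧ ∀ A ∈ S, ∃ c ∈ X, c ∈ A := by
  classical
  let N := d * p + 1
  let B : ℝ := (N : ℝ) ^ (d + 1) * (d + 1)
  have hB : 0 < B := by positivity
  obtain ⟨n, hn⟩ := exists_weak_net hd (one_div_pos.2 hB)
  refine ⟨n, fun S hS h => ?_⟩
  rcases S.eq_empty_or_nonempty with rfl | hne
  · exact ⟨∅, by simp, by simp⟩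
  have : Nonempty S := hne.to_subtype
  obtain ⟨κ, _, μ, x, hμ0, hμ1, hμ⟩ := exists_weights_forall_le_mass (ι := S)
    (C := fun A => (A : Set E)) (β := 1 / B) (by
      intro w hw0 hw1
      obtain ⟨x, hx⟩ := exists_tupleMass_le_mass hd hw0 hw1 (C := fun A : S => (A : Set E))
        (fun A => (hS A A.2).2.1) (fun A => (hS A A.2).2.2)
      have h1 := one_le_mul_tupleMass (κ := Fin (d + 1)) (N := N) hw0 hw1
        (P := fun t => ∃ y, ∀ k, y ∈ (t k : Set E))
        (exists_injective_mem_of_forall_card_eq (fun A hA => (hS A hA).1) h)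
      refine ⟨x, ?_⟩
      rw [div_le_iff₀ hB]
      rw [Fintype.card_fin] at h1
      calc (1 : ℝ) ≤ _ := h1
        _ ≤ (N : ℝ) ^ (d + 1) * ((d + 1) * mass w fun A => x ∈ (A : Set E)) :=
          mul_le_mul_of_nonneg_left hx (by positivity)
        _ = _ := by ring)
  obtain ⟨X, hX, hXS⟩ := hn κ μ x hμ0 hμ1
  exact ⟨X, hX, fun A hA => hXS A (hS A hA).2.2 (hμ ⟨A, hA⟩)⟩

/-! ### Infinite families -/

/-- If all finite subfamilies of a family of compact sets are pierced by `n` points, then so is the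
family: take limits of the `n` points along an ultrafilter. -/
theorem exists_piercing_of_forall_finset {E : Type*} [TopologicalSpace E] [T2Space E] [Nonempty E]
    {n : ℕ} {H : Set (Set E)} (hH : ∀ A ∈ H, IsCompact A)
    (h : ∀ S : Finset (Set E), (S : Set (Set E)) ⊆ H →
      ∃ X : Finset E, X.card ≤ n ∧ ∀ A ∈ S, ∃ c ∈ X, c ∈ A) :
    ∃ y : Fin n → E, ∀ A ∈ H, ∃ i, y i ∈ A := by
  classical
  have h' : ∀ S : Finset H, ∃ x : Fin n → E, ∀ A ∈ S, ∃ i, x i ∈ (A : Set E) := by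
    intro S
    obtain ⟨X, hX, hXS⟩ := h (S.image Subtype.val) (by
      intro A hA
      obtain ⟨B, -, rfl⟩ := Finset.mem_image.1 (Finset.mem_coe.1 hA)
      exact B.2)
    refine ⟨fun i => if hi : (i : ℕ) < X.card then X.equivFin.symm ⟨i, hi⟩
      else Classical.arbitrary E, fun A hA => ?_⟩
    obtain ⟨c, hc, hcA⟩ := hXS A (Finset.mem_image_of_mem _ hA)
    let j := X.equivFin ⟨c, hc⟩
    refine ⟨⟨j, j.2.trans_le hX⟩, ?_⟩
    simpa [j] using hcA
  choose x hx using h'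
  let U : Ultrafilter (Finset H) := Ultrafilter.of Filter.atTop
  have hy : ∀ i, ∃ y : E, ∀ a, (↑(U.map fun S => x S i) : Filter E) ≤ nhds a → a = y := by
    intro i
    by_cases hlim : ∃ y, (↑(U.map fun S => x S i) : Filter E) ≤ nhds y
    · obtain ⟨y, hy⟩ := hlim
      exact ⟨y, fun a ha => tendsto_nhds_unique ha hy⟩
    · exact ⟨Classical.arbitrary E, fun a ha => absurd ⟨a, ha⟩ hlim⟩
  choose y hy using hy
  refine ⟨y, fun A hA => ?_⟩
  have hev : ∀ᶠ S in (U : Filter (Finset H)), ∃ i, x S i ∈ A := by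
    refine Ultrafilter.of_le Filter.atTop ?_
    filter_upwards [Filter.eventually_ge_atTop ({⟨A, hA⟩} : Finset H)] with S hS
    exact hx S ⟨A, hA⟩ (hS (Finset.mem_singleton_self _))
  obtain ⟨i, hi⟩ := Ultrafilter.eventually_exists_iff.1 hev
  obtain ⟨a, haA, ha⟩ := (hH A hA).ultrafilter_le_nhds (U.map fun S => x S i)
    (Filter.le_principal_iff.2 hi)
  exact ⟨i, hy i a ha ▸ haA⟩

theorem isPierceable_of_forall_exists_mem {α : Type*} {n : ℕ} {H : Set (Set α)} (y : Fin n → α)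
    (hy : ∀ A ∈ H, ∃ i, y i ∈ A) : IsPierceable n H := by
  choose c hc using hy
  refine ⟨fun i => {A | ∃ hA : A ∈ H, c A hA = i}, fun i j hij => ?_, ?_, fun i => ⟨y i, ?_⟩⟩
  · refine Set.disjoint_left.2 ?_
    rintro A ⟨hA, rfl⟩ ⟨_, rfl⟩
    exact hij rfl
  · ext A
    simp
  · rintro A ⟨hA, rfl⟩
    exact hc A hA

theorem exists_isPierceable_of_piercingNumber_lt {α : Type*} {H : Set (Set α)} {m : ℕ∞}
    (h : piercingNumber H < m) : ∃ k : ℕ, (k : ℕ∞) < m ∧ IsPierceable k H := by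
  obtain ⟨_, ⟨k, rfl, hk⟩, hlt⟩ := sInf_lt_iff.1 h
  exact ⟨k, hlt, hk⟩

/-- The **Alon–Kleitman theorem**: the numbers `M(p, d + 1; d)` are finite. -/
theorem pqNumber_lt_top (p d : ℕ) : pqNumber p (d + 1) d < ⊤ := by
  obtain ⟨n, hn⟩ := exists_forall_finset_piercing (E := EuclideanSpace ℝ (Fin d))
    finrank_euclideanSpace_fin p
  refine lt_of_le_of_lt (sSup_le ?_) (ENat.natCast_lt_top n)
  rintro _ ⟨H, hH, ⟨-, hpq⟩, rfl⟩
  obtain ⟨y, hy⟩ := exists_piercing_of_forall_finset (n := n) (fun A hA => (hH A hA).2.1)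
    (fun S hS => hn S (fun A hA => hH A (hS hA))
      fun U hU hUp => hpq U (fun A hA => hS (hU hA)) hUp)
  exact sInf_le ⟨n, rfl, isPierceable_of_forall_exists_mem y hy⟩

/-! ### Families with small piercing numbers of subfamilies -/

theorem theorem1p2 (d x : ℕ) (hd : 1 ≤ d)
    (F : Set (Set (EuclideanSpace ℝ (Fin d))))
    (hF : ∀ A ∈ F, IsCompact A ∧ Convex ℝ A)
    (hcard : (x : ℕ∞) ≤ F.encard)
    (hx : ∀ F' ⊆ F, F'.encard = x → piercingNumber F' < (⌈(x : ℝ) / (d : ℝ)⌉₊ : ℕ∞)) :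
    piercingNumber F ≤ pqNumber x (d + 1) d ∧ pqNumber x (d + 1) d < ⊤ := by
  classical
  have hpierce : ∀ F' ⊆ F, F'.encard = x → ∃ k : ℕ, k * d < x ∧ IsPierceable k F' := by
    intro F' hF' hF'x
    obtain ⟨k, hk, hkF⟩ := exists_isPierceable_of_piercingNumber_lt (hx F' hF' hF'x)
    refine ⟨k, ?_, hkF⟩
    rw [Nat.cast_lt, Nat.lt_ceil, lt_div_iff₀ (by exact_mod_cast hd)] at hk
    exact_mod_cast hk
  have hx1 : 1 ≤ x := by
    obtain ⟨F', hF', hF'x⟩ := Set.exists_subset_encard_eq hcard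
    obtain ⟨k, hk, -⟩ := hpierce F' hF' hF'x
    lia
  have hne : ∀ A ∈ F, A.Nonempty := by
    intro A hA
    obtain ⟨F', hAF', hF', hF'x⟩ := Set.exists_superset_subset_encard_eq
      (Set.singleton_subset_iff.2 hA) (by rw [Set.encard_singleton]; exact_mod_cast hx1) hcard
    obtain ⟨k, -, G, -, hG, hGne⟩ := hpierce F' hF' hF'x
    have hAG : A ∈ ⋃ i, G i := hG ▸ hAF' rfl
    obtain ⟨i, hi⟩ := Set.mem_iUnion.1 hAG
    exact (hGne i).mono (Set.sInter_subset_of_mem hi)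
  refine ⟨le_sSup ⟨F, fun A hA => ⟨hne A hA, hF A hA⟩, ⟨hcard, fun S hS hSx => ?_⟩, rfl⟩,
    pqNumber_lt_top x d⟩
  obtain ⟨k, hk, G, -, hG, hGne⟩ := hpierce S hS
    (by rw [Set.encard_coe_eq_coe_finsetCard, hSx])
  have hcol : ∀ A : S, ∃ i, (A : Set _) ∈ G i := fun A =>
    Set.mem_iUnion.1 (hG ▸ Finset.mem_coe.2 A.2)
  choose c hc using hcol
  -- Some part has more than `d` members, as `x > k * d`.
  obtain ⟨i, hi⟩ := Fintype.exists_lt_card_fiber_of_mul_lt_card (n := d) c (by simpa [hSx] using hk)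
  obtain ⟨T, hT, hTd⟩ := Finset.exists_subset_card_eq (Nat.succ_le_of_lt hi)
  refine ⟨T.map (Function.Embedding.subtype _), fun A hA => ?_, by rw [Finset.card_map, hTd],
    (hGne i).mono ?_⟩
  · obtain ⟨B, -, rfl⟩ := Finset.mem_map.1 hA
    exact B.2
  · refine Set.sInter_subset_sInter fun A hA => ?_
    obtain ⟨B, hB, rfl⟩ := Finset.mem_map.1 (Finset.mem_coe.1 hA)
    exact (Finset.mem_filter.1 (hT hB)).2 ▸ hc B
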